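/- Let $U, V$ be linear subspaces of $\mathbb{R}^n$ with $1 \le p := \dim U \le q := \dim V \le n-1$, let $s := \dim(U\cap V)$, and write $P_W$ for the orthogonal projection onto a subspace $W$. Let $\theta_1,\dots,\theta_p\in[0,\frac{\pi}{2}]$ be the principal angles between $U$ and $V$: recursively, $\cos\theta_k=\langle u_k,v_k\rangle$ is the maximum of $\langle u,v\rangle$ over all unit vectors $u\in U$, $v\in V$ with $\langle u,u_j\rangle=\langle v,v_j\rangle=0$ for $1\le j<k$, and $(u_k,v_k)$ is a maximizing pair. A linear operator $A$ on $\mathbb{R}^n$ is convergent to $A^\infty$ if $\|A^k-A^\infty\|\to 0$ in operator norm, and convergent if it is convergent to some $A^\infty$; a number $r\in[0,1)$ is a convergence rate of $A$ if there are $M,N>0$ with $\|A^k-A^\infty\|\le M r^k$ for all integers $k>N$; if there is a smallest convergence rate, it is called the optimal one. Let $\gamma(A):=\max\{|\lambda| : \lambda\in\{0\}\cup\sigma(A)\setminus\{1\}\}$, where $\sigma(A)$ is the set of complex eigenvalues of $A$. For $\mu\in\mathbb{R}$ put $$S_\mu := P_U\big((1-\mu)\,\mathrm{Id}+\mu P_V\big)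 = (1-\mu)P_U+\mu P_UP_V .$$ If $U\subseteq V$, then $S_\mu$ is convergent to $P_{U\cap V}=P_U$ for every $\mu\in\mathbb{R}$. Suppose now that $U\not\subseteq V$, so that $s+1\le p$. Then $S_\mu$ is convergent if and only if $\mu\in\big[0,\frac{2}{\sin^2\theta_p}\big)$. Moreover: (i) If $\mu\in\big(0,\frac{2}{\sin^2\theta_{s+1}+\sin^2\theta_p}\big]$, then $S_\mu$ is convergent to $P_{U\cap V}$ with the optimal convergence rate $\gamma(S_\mu)=1-\mu\sin^2\theta_{s+1}$. (ii) If $\mu\in\big(\frac{2}{\sin^2\theta_{s+1}+\sin^2\theta_p},\frac{2}{\sin^2\theta_p}\big)$, then $S_\mu$ is convergent to $P_{U\cap V}$ with the optimal convergence rate $\gamma(S_\mu)=\mu\sin^2\theta_p-1$. Consequently, for $\mu\ne 0$, $S_\mu$ is convergent to $P_{U\cap V}$ with optimal convergence rate smaller than $\cos^2\theta_{s+1}=c_F^2(U,V)$ if and only if $\mu\in\big(1,\frac{2-\sin^2\theta_{s+1}}{\sin^2\theta_p}\big)$; here $c_F(U,V)$, the cosine of the Friedrichs angle, is the maximum of $\langle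 u,v\rangle$ over unit vectors $u\in U\cap(U\cap V)^\perp$, $v\in V\cap(U\cap V)^\perp$. Furthermore, among all $\mu\neq 0$ for which $S_\mu$ is convergent, the smallest convergence rate is $\frac{\sin^2\theta_p-\sin^2\theta_{s+1}}{\sin^2\theta_{s+1}+\sin^2\theta_p}$, and it is attained, as the optimal convergence rate of $S_\mu$, at $\mu=\frac{2}{\sin^2\theta_{s+1}+\sin^2\theta_p}$. -/

import Mathlib

open Filter Topology Module

noncomputable section

namespace AltProj

section Rates

variable {R : Type*} [NormedRing R]

/-- The powers of `A` converge in norm to `L`. For operators on a Euclidean space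
the norm is the operator norm. -/
def ConvergesTo (A L : R) : Prop :=
  Tendsto (fun k : ℕ => ‖A ^ k - L‖) atTop (𝓝 0)

/-- The powers of `A` have a limit. -/
def Convergent (A : R) : Prop := ∃ L : R, ConvergesTo A L

/-- `r ∈ [0, 1)` is a (linear) convergence rate of the powers of `A` towards `L`. -/
def IsConvergenceRate (A L : R) (r : ℝ) : Prop :=
  r ∈ Set.Ico (0 : ℝ) 1 ∧
    ∃ M : ℝ, 0 < M ∧ ∃ N : ℕ, 0 < N ∧ ∀ k : ℕ, N < k → ‖A ^ k - L‖ ≤ M * r ^ k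

/-- `r` is the optimal convergence rate: the infimum of all convergence rates, and attained. -/
def IsOptimalRate (A L : R) (r : ℝ) : Prop :=
  IsLeast {t : ℝ | IsConvergenceRate A L t} r

end Rates

/-- The set of all complex eigenvalues of an operator on `ℝⁿ`, that is, the spectrum of its
matrix in the standard basis, read as a complex matrix. -/
def complexSpectrum {n : ℕ}
    (A : EuclideanSpace ℝ (Fin n) →L[ℝ] EuclideanSpace ℝ (Fin n)) : Set ℂ :=
  spectrum ℂ (((Matrix.toEuclideanCLM (n := Fin n) (𝕜 := ℝ)).symm A).map Complex.ofReal)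

/-- `γ(A)`, the largest modulus of an element of `{0} ∪ σ(A) \ {1}`. -/
def subdominantModulus {n : ℕ}
    (A : EuclideanSpace ℝ (Fin n) →L[ℝ] EuclideanSpace ℝ (Fin n)) : ℝ :=
  sSup ((fun z : ℂ => ‖z‖) '' ({0} ∪ complexSpectrum A \ {1}))

section Angles

variable {n : ℕ} (U V : Submodule ℝ (EuclideanSpace ℝ (Fin n)))

/-- The pairs of unit vectors `x.1 ∈ U`, `x.2 ∈ V` that compete in the definition of the `k`-th
principal angle, given the principal vectors `u j`, `v j` for `1 ≤ j < k`. -/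
def principalPairs (u v : ℕ → EuclideanSpace ℝ (Fin n)) (k : ℕ) :
    Set (EuclideanSpace ℝ (Fin n) × EuclideanSpace ℝ (Fin n)) :=
  {x | x.1 ∈ U ∧ x.2 ∈ V ∧ ‖x.1‖ = 1 ∧ ‖x.2‖ = 1 ∧
    ∀ j ∈ Set.Ico 1 k, inner ℝ x.1 (u j) = 0 ∧ inner ℝ x.2 (v j) = 0}

/-- `θ 1, …, θ p`, with `p = dim U`, are the principal angles between `U` and `V`: for some choice
of principal vectors, `cos (θ k) = ⟪u k, v k⟫` is the maximum of `⟪x, y⟫` over the pairs `(x, y)`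
competing at stage `k`. Values of `θ` outside `1, …, p` are irrelevant. -/
def IsPrincipalAngles (θ : ℕ → ℝ) : Prop :=
  ∃ u v : ℕ → EuclideanSpace ℝ (Fin n), ∀ k ∈ Set.Icc 1 (finrank ℝ U),
    θ k ∈ Set.Icc 0 (Real.pi / 2) ∧
    (u k, v k) ∈ principalPairs U V u v k ∧
    Real.cos (θ k) = inner ℝ (u k) (v k) ∧
    IsGreatest ((fun x => inner ℝ x.1 x.2) '' principalPairs U V u v k) (Real.cos (θ k))

/-- `c_F(U, V)`, the cosine of the Friedrichs angle. The supremum is a maximum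
whenever neither subspace contains the other. -/
def friedrichsCos : ℝ :=
  sSup {c : ℝ | ∃ u ∈ U ⊓ (U ⊓ V)ᗮ, ∃ v ∈ V ⊓ (U ⊓ V)ᗮ,
    ‖u‖ = 1 ∧ ‖v‖ = 1 ∧ c = inner ℝ u v}

/-- The partial relaxed alternating projection `S_μ = (1 - μ) P_U + μ P_U P_V`. -/
def partialRelaxed (μ : ℝ) : EuclideanSpace ℝ (Fin n) →L[ℝ] EuclideanSpace ℝ (Fin n) :=
  (1 - μ) • U.starProjection + μ • (U.starProjection * V.starProjection)

theorem partialRelaxed_eq (μ : ℝ) :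
    partialRelaxed U V μ = U.starProjection * ((1 - μ) • 1 + μ • V.starProjection) := by
  simp [partialRelaxed, mul_add]

variable {U V}

theorem exists_unit_orthogonal (W : Submodule ℝ (EuclideanSpace ℝ (Fin n)))
    (w : ℕ → EuclideanSpace ℝ (Fin n)) (k : ℕ) (hk : k < finrank ℝ W) :
    ∃ x ∈ W, ‖x‖ = 1 ∧ ∀ j ∈ Set.Ico 1 (k + 1), inner ℝ x (w j) = 0 := by
  let f : W →ₗ[ℝ] (Fin k → ℝ) :=
    LinearMap.pi fun i => (innerₛₗ ℝ (w (i + 1))).comp W.subtype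
  have hf : LinearMap.ker f ≠ ⊥ := by
    apply LinearMap.ker_ne_bot_of_finrank_lt
    simpa using hk
  obtain ⟨x, hx, hx0⟩ := Submodule.exists_mem_ne_zero_of_ne_bot hf
  have hx0' : (x : EuclideanSpace ℝ (Fin n)) ≠ 0 := by simpa using hx0
  refine ⟨(‖(x : EuclideanSpace ℝ (Fin n))‖)⁻¹ • (x : EuclideanSpace ℝ (Fin n)),
    W.smul_mem _ x.2, norm_smul_inv_norm (𝕜 := ℝ) hx0', fun j hj => ?_⟩
  have h1 := congrFun (LinearMap.mem_ker.1 hx) ⟨j - 1, by have := hj.1; have := hj.2; omega⟩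
  have h2 : inner ℝ (w j) (x : EuclideanSpace ℝ (Fin n)) = 0 := by
    have h3 : j - 1 + 1 = j := Nat.sub_add_cancel hj.1
    simpa [f, h3] using h1
  rw [real_inner_smul_left, real_inner_comm, h2, mul_zero]

theorem principalPairs_congr {u v u' v' : ℕ → EuclideanSpace ℝ (Fin n)} {k : ℕ}
    (h : ∀ j < k, u j = u' j ∧ v j = v' j) :
    principalPairs U V u v k = principalPairs U V u' v' k := by
  ext x
  simp only [principalPairs, Set.mem_ofPred_eq]
  refine and_congr_right fun _ => and_congr_right fun _ => and_congr_right fun _ =>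
    and_congr_right fun _ => forall₂_congr fun j hj => ?_
  rw [(h j hj.2).1, (h j hj.2).2]

theorem exists_max_principalPairs (u v : ℕ → EuclideanSpace ℝ (Fin n)) (k : ℕ)
    (hU : k < finrank ℝ U) (hV : k < finrank ℝ V) :
    ∃ x ∈ principalPairs U V u v (k + 1), ∀ y ∈ principalPairs U V u v (k + 1),
      inner ℝ y.1 y.2 ≤ inner ℝ x.1 x.2 := by
  have hne : (principalPairs U V u v (k + 1)).Nonempty := by
    obtain ⟨x, hx, hx1, hx2⟩ := exists_unit_orthogonal U u k hU
    obtain ⟨y, hy, hy1, hy2⟩ := exists_unit_orthogonal V v k hV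
    exact ⟨(x, y), hx, hy, hx1, hy1, fun j hj => ⟨hx2 j hj, hy2 j hj⟩⟩
  have hcl : IsClosed (principalPairs U V u v (k + 1)) := by
    have hUc : IsClosed (U : Set (EuclideanSpace ℝ (Fin n))) := U.closed_of_finiteDimensional
    have hVc : IsClosed (V : Set (EuclideanSpace ℝ (Fin n))) := V.closed_of_finiteDimensional
    have hlast : IsClosed {x : EuclideanSpace ℝ (Fin n) × EuclideanSpace ℝ (Fin n) |
        ∀ j ∈ Set.Ico 1 (k + 1), inner ℝ x.1 (u j) = 0 ∧ inner ℝ x.2 (v j) = 0} := by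
      simp only [Set.ofPred_forall]
      exact isClosed_iInter fun j => isClosed_iInter fun _ =>
        (isClosed_eq (by fun_prop) continuous_const).inter
          (isClosed_eq (by fun_prop) continuous_const)
    exact (hUc.preimage continuous_fst).inter ((hVc.preimage continuous_snd).inter
      ((isClosed_eq (by fun_prop) continuous_const).inter
      ((isClosed_eq (by fun_prop) continuous_const).inter hlast)))
  have hb : Bornology.IsBounded (principalPairs U V u v (k + 1)) := by
    refine (Metric.isBounded_closedBall (x := (0 : EuclideanSpace ℝ (Fin n) ×
      EuclideanSpace ℝ (Fin n))) (r := 1)).subset fun x hx => ?_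
    rw [mem_closedBall_zero_iff, Prod.norm_def, hx.2.2.1, hx.2.2.2.1, max_self]
  obtain ⟨x, hx, hmax⟩ := (Metric.isCompact_of_isClosed_isBounded hcl hb).exists_isMaxOn hne
    (f := fun x => inner ℝ x.1 x.2) (by fun_prop)
  exact ⟨x, hx, fun y hy => hmax hy⟩

/-- Principal angles exist as soon as `dim U ≤ dim V`. -/
theorem exists_isPrincipalAngles (h : finrank ℝ U ≤ finrank ℝ V) :
    ∃ θ, IsPrincipalAngles U V θ := by
  have key : ∀ m ≤ finrank ℝ U, ∃ u v : ℕ → EuclideanSpace ℝ (Fin n), ∀ k ∈ Set.Icc 1 m,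
      (u k, v k) ∈ principalPairs U V u v k ∧
      ∀ y ∈ principalPairs U V u v k, inner ℝ y.1 y.2 ≤ inner ℝ (u k) (v k) := by
    intro m
    induction m with
    | zero => exact fun _ => ⟨0, 0, fun k hk => by have := hk.1; have := hk.2; omega⟩
    | succ m ih =>
      intro hm
      obtain ⟨u, v, huv⟩ := ih (by omega)
      obtain ⟨x, hx, hmax⟩ := exists_max_principalPairs (U := U) (V := V) u v m
        (by omega) (by omega)
      refine ⟨Function.update u (m + 1) x.1, Function.update v (m + 1) x.2, fun k hk => ?_⟩
      have hc : principalPairs U V (Function.update u (m + 1) x.1)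
          (Function.update v (m + 1) x.2) k = principalPairs U V u v k := by
        apply principalPairs_congr
        intro j hj
        have hne : j ≠ m + 1 := by have := hk.2; omega
        simp [hne]
      rw [hc]
      by_cases hkm : k = m + 1
      · subst hkm
        simpa using ⟨hx, fun a b hab => hmax (a, b) hab⟩
      · have := huv k ⟨hk.1, by have := hk.2; omega⟩
        simpa [hkm] using this
  obtain ⟨u, v, huv⟩ := key _ le_rfl
  refine ⟨fun k => Real.arccos (inner ℝ (u k) (v k)), u, v, fun k hk => ?_⟩
  obtain ⟨hmem, hmax⟩ := huv k hk
  have hle : inner ℝ (u k) (v k) ≤ 1 := by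
    have := real_inner_le_norm (u k) (v k)
    rwa [hmem.2.2.1, hmem.2.2.2.1, mul_one] at this
  have hge : 0 ≤ inner ℝ (u k) (v k) := by
    have hneg : (-u k, v k) ∈ principalPairs U V u v k := by
      refine ⟨U.neg_mem hmem.1, hmem.2.1, by simpa using hmem.2.2.1, hmem.2.2.2.1,
        fun j hj => ⟨?_, (hmem.2.2.2.2 j hj).2⟩⟩
      simpa using (hmem.2.2.2.2 j hj).1
    have := hmax _ hneg
    simp only [inner_neg_left] at this
    linarith
  have hcos : Real.cos (Real.arccos (inner ℝ (u k) (v k))) = inner ℝ (u k) (v k) :=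
    Real.cos_arccos (by linarith) hle
  refine ⟨⟨Real.arccos_nonneg _, Real.arccos_le_pi_div_two.2 hge⟩, hmem, hcos, ?_⟩
  simp only [hcos]
  exact ⟨⟨_, hmem, rfl⟩, by rintro _ ⟨y, hy, rfl⟩; exact hmax y hy⟩

end Angles

end AltProj

end

/-! The principal vectors `u 1, …, u p` form an orthonormal basis of `U`, and `P_V u_k = cos θ_k
v_k`, `P_U v_k = cos θ_k u_k` (`starProjection_eq`). So `S_μ u_k = (1 - μ sin² θ_k) u_k`. The first
`s` angles vanish and their vectors span `U ∩ V`; all later angles are positive.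

Upper bound: `S_μ` maps into `U`, where it is symmetric, so on `U` the norm of `S_μ - P_{U∩V}` is
the maximum of `|1 - μ sin² θ_k|` over `k > s`. Since `S_μ^k - P_{U∩V} = (S_μ - P_{U∩V})^k` for `k ≥
1`, this maximum, if below 1, is a rate (`isConvergenceRate`). Lower bound: a rate dominates the
modulus of every eigenvalue other than 1 (`IsConvergenceRate.norm_le`), so the maximum is optimal.

What remains is the function `t ↦ |1 - μ t|` on `[sin² θ_{s+1}, sin² θ_p]`: by convexity its maximum
is at an endpoint, and for `μ > 0` the two endpoints balance at `μ = 2 / (sin² θ_{s+1} + sin² θ_p)`.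
-/

namespace AltProj

/-! ### Eigenvalues as lower bounds for convergence rates -/

section Spectral

variable {n : ℕ}

/-- The algebra homomorphism sending an operator on `ℝⁿ` to its complexified matrix. -/
noncomputable def complexMatrix :
    (EuclideanSpace ℝ (Fin n) →L[ℝ] EuclideanSpace ℝ (Fin n)) →ₐ[ℝ] Matrix (Fin n) (Fin n) ℂ :=
  Complex.ofRealAm.mapMatrix.comp
    (Matrix.toEuclideanCLM (n := Fin n) (𝕜 := ℝ)).symm.toAlgEquiv.toAlgHom

attribute [local instance] Matrix.linftyOpNormedRing Matrix.linftyOpNormedAlgebra in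
theorem exists_norm_le_of_mem_spectrum_complexMatrix :
    ∃ C : ℝ, 0 ≤ C ∧ ∀ B : EuclideanSpace ℝ (Fin n) →L[ℝ] EuclideanSpace ℝ (Fin n),
      ∀ z ∈ spectrum ℂ (complexMatrix B), ‖z‖ ≤ C * ‖B‖ := by
  obtain ⟨C, hC, hf⟩ := SemilinearMapClass.bound_of_continuous
    (complexMatrix (n := n)).toLinearMap (LinearMap.continuous_of_finiteDimensional _)
  refine ⟨C * ‖(1 : Matrix (Fin n) (Fin n) ℂ)‖, by positivity, fun B z hz => ?_⟩
  calc ‖z‖ ≤ ‖complexMatrix B‖ * ‖(1 : Matrix (Fin n) (Fin n) ℂ)‖ :=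
        spectrum.norm_le_norm_mul_of_mem hz
    _ ≤ C * ‖B‖ * ‖(1 : Matrix (Fin n) (Fin n) ℂ)‖ := by gcongr; exact hf B
    _ = _ := by ring

/-- Spectral mapping for `X^(k+1) - X^k`. Differences of consecutive powers make the limit
disappear, and the factor `z - 1` singles out the eigenvalue 1. The constant is uniform in `k`. -/
theorem exists_norm_pow_mul_le (A : EuclideanSpace ℝ (Fin n) →L[ℝ] EuclideanSpace ℝ (Fin n)) :
    ∃ C : ℝ, 0 ≤ C ∧ ∀ z ∈ complexSpectrum A, ∀ k : ℕ,
      ‖z‖ ^ k * ‖z - 1‖ ≤ C * ‖A ^ (k + 1) - A ^ k‖ := by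
  obtain ⟨C, hC, h⟩ := exists_norm_le_of_mem_spectrum_complexMatrix (n := n)
  refine ⟨C, hC, fun z hz k => ?_⟩
  have h1 := spectrum.subset_polynomial_aeval (𝕜 := ℂ) (complexMatrix A)
    (Polynomial.X ^ (k + 1) - Polynomial.X ^ k) ⟨z, hz, rfl⟩
  have h2 : Polynomial.aeval (complexMatrix A)
      (Polynomial.X ^ (k + 1) - Polynomial.X ^ k : Polynomial ℂ) =
      complexMatrix (A ^ (k + 1) - A ^ k) := by simp
  rw [h2] at h1
  have h3 := h _ _ h1
  have h4 : Polynomial.eval z (Polynomial.X ^ (k + 1) - Polynomial.X ^ k : Polynomial ℂ) =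
      z ^ k * (z - 1) := by simp; ring
  simpa only [h4, norm_mul, norm_pow] using h3

/-- A real eigenvalue is a root of the real characteristic polynomial, hence of its
complexification. -/
theorem ofReal_mem_complexSpectrum
    {A : EuclideanSpace ℝ (Fin n) →L[ℝ] EuclideanSpace ℝ (Fin n)} {l : ℝ}
    {x : EuclideanSpace ℝ (Fin n)} (hx : x ≠ 0) (h : A x = l • x) :
    (l : ℂ) ∈ complexSpectrum A := by
  have h1 : l ∈ spectrum ℝ A := by
    rintro ⟨u, hu⟩
    apply hx
    have h2 : (u : EuclideanSpace ℝ (Fin n) →L[ℝ] EuclideanSpace ℝ (Fin n)) x = 0 := by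
      rw [hu]; simp [h, Algebra.algebraMap_eq_smul_one]
    have h3 := DFunLike.congr_fun u.inv_mul x
    rw [mul_apply_eq_comp, h2, map_zero] at h3
    exact h3.symm
  rw [← AlgEquiv.spectrum_eq (Matrix.toEuclideanCLM (n := Fin n) (𝕜 := ℝ)).symm.toAlgEquiv A,
    Matrix.mem_spectrum_iff_isRoot_charpoly] at h1
  apply Matrix.mem_spectrum_of_isRoot_charpoly
  have h2 := h1.map (f := Complex.ofRealHom)
  rwa [← Matrix.charpoly_map] at h2

theorem IsConvergenceRate.norm_le {A L : EuclideanSpace ℝ (Fin n) →L[ℝ] EuclideanSpace ℝ (Fin n)}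
    {r : ℝ} (h : IsConvergenceRate A L r) {z : ℂ} (hz : z ∈ complexSpectrum A) (hz1 : z ≠ 1) :
    ‖z‖ ≤ r := by
  obtain ⟨⟨hr0, hr1⟩, M, hM, N, hN, hk⟩ := h
  obtain ⟨C, hC, hA⟩ := exists_norm_pow_mul_le A
  have hd : 0 < ‖z - 1‖ := norm_pos_iff.2 (sub_ne_zero.2 hz1)
  -- Consecutive powers are within `2 M r^k`, so `‖z‖^k` is at most a constant times `r^k`; this
  -- fails for large `k` if `r < ‖z‖`.
  have hb : ∀ k : ℕ, N < k → ‖z‖ ^ k ≤ C * (2 * M) / ‖z - 1‖ * r ^ k := by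
    intro k hNk
    have h1 : ‖A ^ (k + 1) - A ^ k‖ ≤ 2 * M * r ^ k := by
      calc ‖A ^ (k + 1) - A ^ k‖ = ‖(A ^ (k + 1) - L) - (A ^ k - L)‖ := by congr 1; abel
        _ ≤ M * r ^ (k + 1) + M * r ^ k :=
          (norm_sub_le _ _).trans (add_le_add (hk _ (by omega)) (hk _ hNk))
        _ ≤ M * r ^ k + M * r ^ k := by
          gcongr ?_ + _
          exact mul_le_mul_of_nonneg_left (pow_le_pow_of_le_one hr0 hr1.le (by omega)) hM.le
        _ = _ := by ring
    rw [div_mul_eq_mul_div, le_div_iff₀ hd, mul_assoc C]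
    exact (hA z hz k).trans (mul_le_mul_of_nonneg_left h1 hC)
  by_contra! hlt
  have hz0 : 0 < ‖z‖ := hr0.trans_lt hlt
  have ht : Tendsto (fun k : ℕ => C * (2 * M) / ‖z - 1‖ * (r / ‖z‖) ^ k) atTop (𝓝 0) := by
    simpa using (tendsto_pow_atTop_nhds_zero_of_lt_one (by positivity)
      ((div_lt_one hz0).2 hlt)).const_mul (C * (2 * M) / ‖z - 1‖)
  obtain ⟨k, hk1, hk2⟩ := ((ht.eventually_lt_const one_pos).and (eventually_gt_atTop N)).exists
  have := hb k hk2
  rw [div_pow, ← mul_div_assoc, div_lt_one (by positivity)] at hk1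
  linarith

theorem Convergent.eq_one_or_norm_lt_one
    {A : EuclideanSpace ℝ (Fin n) →L[ℝ] EuclideanSpace ℝ (Fin n)}
    (h : Convergent A) {z : ℂ} (hz : z ∈ complexSpectrum A) : z = 1 ∨ ‖z‖ < 1 := by
  obtain ⟨L, hL⟩ := h
  obtain ⟨C, hC, hA⟩ := exists_norm_pow_mul_le A
  by_contra! hc
  obtain ⟨hz1, hz2⟩ := hc
  have hd : 0 < ‖z - 1‖ := norm_pos_iff.2 (sub_ne_zero.2 hz1)
  have ht : Tendsto (fun k : ℕ => C * (‖A ^ (k + 1) - L‖ + ‖A ^ k - L‖)) atTop (𝓝 0) := by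
    have hL' : Tendsto (fun k : ℕ => ‖A ^ k - L‖) atTop (𝓝 0) := hL
    have h1 : Tendsto (fun k : ℕ => ‖A ^ (k + 1) - L‖) atTop (𝓝 0) :=
      hL'.comp (tendsto_add_atTop_nat 1)
    simpa using (h1.add hL').const_mul C
  obtain ⟨k, hk⟩ := (ht.eventually_lt_const hd).exists
  have h1 : ‖A ^ (k + 1) - A ^ k‖ ≤ ‖A ^ (k + 1) - L‖ + ‖A ^ k - L‖ := by
    calc ‖A ^ (k + 1) - A ^ k‖ = ‖(A ^ (k + 1) - L) - (A ^ k - L)‖ := by congr 1; abel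
      _ ≤ _ := norm_sub_le _ _
  have h2 := hA z hz k
  have h3 : ‖z - 1‖ ≤ ‖z‖ ^ k * ‖z - 1‖ := le_mul_of_one_le_left hd.le (one_le_pow₀ hz2)
  have h4 := mul_le_mul_of_nonneg_left h1 hC
  linarith

theorem IsConvergenceRate.convergesTo {R : Type*} [NormedRing R] {A L : R} {r : ℝ}
    (h : IsConvergenceRate A L r) : ConvergesTo A L := by
  obtain ⟨⟨hr0, hr1⟩, M, hM, N, hN, hk⟩ := h
  refine squeeze_zero' (Eventually.of_forall fun _ => norm_nonneg _)
    ((eventually_gt_atTop N).mono hk) ?_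
  simpa using (tendsto_pow_atTop_nhds_zero_of_lt_one hr0 hr1).const_mul M

/-- If the powers of `A` converge at the rate `r`, and `r` is the modulus of an element
of `σ(A) \ {1}`, then `r` is optimal and equals the subdominant modulus. -/
theorem IsConvergenceRate.isOptimalRate_of_mem
    {A L : EuclideanSpace ℝ (Fin n) →L[ℝ] EuclideanSpace ℝ (Fin n)} {r : ℝ}
    (h : IsConvergenceRate A L r) {z : ℂ} (hz : z ∈ complexSpectrum A) (hz1 : z ≠ 1)
    (hr : ‖z‖ = r) : IsOptimalRate A L r ∧ subdominantModulus A = r := by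
  refine ⟨⟨h, fun t ht => hr ▸ ht.norm_le hz hz1⟩,
    IsGreatest.csSup_eq ⟨⟨z, Or.inr ⟨hz, hz1⟩, hr⟩, ?_⟩⟩
  rintro _ ⟨w, hw | ⟨hw, hw1⟩, rfl⟩
  · rw [Set.mem_singleton_iff.1 hw]; simpa using h.1.1
  · exact h.norm_le hw hw1

end Spectral

end AltProj

namespace AltProj

/-! ### Principal vectors and the projections -/

section PrincipalVectors

variable {n : ℕ} {U V : Submodule ℝ (EuclideanSpace ℝ (Fin n))}

/-- `θ` are the principal angles realised by the principal vectors `u`, `v`. -/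
def IsPrincipalSystem (U V : Submodule ℝ (EuclideanSpace ℝ (Fin n))) (θ : ℕ → ℝ)
    (u v : ℕ → EuclideanSpace ℝ (Fin n)) : Prop :=
  ∀ k ∈ Set.Icc 1 (finrank ℝ U),
    θ k ∈ Set.Icc 0 (Real.pi / 2) ∧
    (u k, v k) ∈ principalPairs U V u v k ∧
    Real.cos (θ k) = inner ℝ (u k) (v k) ∧
    IsGreatest ((fun x => inner ℝ x.1 x.2) '' principalPairs U V u v k) (Real.cos (θ k))

/-- If `w` behaves like a projection of `x`, and the unit vector `y` with `⟪w, y⟫ = c` is at least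
as well aligned with `x` as the unit multiples of `w`, then `w = c • y`. -/
theorem eq_smul_of_forall_inner_le {E : Type*} [NormedAddCommGroup E] [InnerProductSpace ℝ E]
    {x y w : E} {c : ℝ} (hy : ‖y‖ = 1) (hw : inner ℝ x w = ‖w‖ ^ 2) (hc : inner ℝ w y = c)
    (hc0 : 0 ≤ c) (hmax : ∀ t : ℝ, ‖t • w‖ = 1 → inner ℝ x (t • w) ≤ c) : w = c • y := by
  have h1 : ‖w‖ ≤ c := by
    rcases eq_or_ne w 0 with h0 | h0
    · simpa [h0] using hc0
    · have h2 := hmax ‖w‖⁻¹ (norm_smul_inv_norm (𝕜 := ℝ) h0)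
      have h3 : ‖w‖ ≠ 0 := norm_ne_zero_iff.2 h0
      rw [inner_smul_right, hw] at h2
      field_simp at h2
      linarith
  -- `c • y` is the projection of `w` onto the line of `y`; as `‖w‖ ≤ c`, Pythagoras leaves no
  -- remainder.
  have h2 : ‖w - c • y‖ ^ 2 = ‖w‖ ^ 2 - c ^ 2 := by
    rw [norm_sub_sq_real, inner_smul_right, hc, norm_smul, hy, Real.norm_eq_abs, mul_one, sq_abs]
    ring
  have h3 : ‖w - c • y‖ ^ 2 ≤ 0 := by nlinarith [norm_nonneg w]
  exact sub_eq_zero.1 (norm_eq_zero.1 (pow_eq_zero_iff two_ne_zero |>.1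
    (le_antisymm h3 (sq_nonneg _))))

namespace IsPrincipalSystem

variable {θ : ℕ → ℝ} {u v : ℕ → EuclideanSpace ℝ (Fin n)} (h : IsPrincipalSystem U V θ u v)
  {j k : ℕ}
include h

theorem cos_nonneg (hk : k ∈ Set.Icc 1 (finrank ℝ U)) : 0 ≤ Real.cos (θ k) :=
  Real.cos_nonneg_of_mem_Icc ⟨by linarith [(h k hk).1.1, Real.pi_pos], (h k hk).1.2⟩

theorem le_cos (hk : k ∈ Set.Icc 1 (finrank ℝ U)) {x : EuclideanSpace ℝ (Fin n) ×
    EuclideanSpace ℝ (Fin n)} (hx : x ∈ principalPairs U V u v k) :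
    inner ℝ x.1 x.2 ≤ Real.cos (θ k) := (h k hk).2.2.2.2 ⟨x, hx, rfl⟩

theorem left_mem (hk : k ∈ Set.Icc 1 (finrank ℝ U)) : u k ∈ U := (h k hk).2.1.1

theorem right_mem (hk : k ∈ Set.Icc 1 (finrank ℝ U)) : v k ∈ V := (h k hk).2.1.2.1

theorem norm_left (hk : k ∈ Set.Icc 1 (finrank ℝ U)) : ‖u k‖ = 1 := (h k hk).2.1.2.2.1

theorem norm_right (hk : k ∈ Set.Icc 1 (finrank ℝ U)) : ‖v k‖ = 1 := (h k hk).2.1.2.2.2.1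

theorem inner_left (hk : k ∈ Set.Icc 1 (finrank ℝ U)) (hj : j ∈ Set.Ico 1 k) :
    inner ℝ (u k) (u j) = 0 := ((h k hk).2.1.2.2.2.2 j hj).1

theorem inner_right (hk : k ∈ Set.Icc 1 (finrank ℝ U)) (hj : j ∈ Set.Ico 1 k) :
    inner ℝ (v k) (v j) = 0 := ((h k hk).2.1.2.2.2.2 j hj).2

/-- The unit multiples of `P_V u_k` compete with `v_k` at stage `k`, because by induction `⟪P_V u_k,
v_j⟫ = ⟪u_k, P_U v_j⟫ = cos θ_j ⟪u_k, u_j⟫ = 0` for `j < k`. Maximality then gives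
`eq_smul_of_forall_inner_le`; the other half is symmetric. -/
theorem starProjection_eq (hk : k ∈ Set.Icc 1 (finrank ℝ U)) :
    V.starProjection (u k) = Real.cos (θ k) • v k ∧
      U.starProjection (v k) = Real.cos (θ k) • u k := by
  induction k using Nat.strong_induction_on with
  | _ k ih =>
    have ih' : ∀ j ∈ Set.Ico 1 k, V.starProjection (u j) = Real.cos (θ j) • v j ∧
      U.starProjection (v j) = Real.cos (θ j) • u j := fun j hj =>
        ih j hj.2 ⟨hj.1, hj.2.le.trans hk.2⟩
    have hc := (h k hk).2.2.1
    constructor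
    · refine eq_smul_of_forall_inner_le (x := u k) (h.norm_right hk) ?_ ?_ (h.cos_nonneg hk) ?_
      · rw [← real_inner_self_eq_norm_sq, V.inner_starProjection_left_eq_right,
          Submodule.starProjection_eq_self_iff.2 (V.starProjection_apply_mem _)]
      · rw [V.inner_starProjection_left_eq_right,
          Submodule.starProjection_eq_self_iff.2 (h.right_mem hk), hc]
      · intro t ht
        refine h.le_cos hk (x := (u k, t • V.starProjection (u k))) ⟨h.left_mem hk,
          V.smul_mem _ (V.starProjection_apply_mem _), h.norm_left hk, ht, fun j hj =>
          ⟨h.inner_left hk hj, ?_⟩⟩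
        rw [inner_smul_left, V.inner_starProjection_left_eq_right,
          Submodule.starProjection_eq_self_iff.2 (h.right_mem ⟨hj.1, hj.2.le.trans hk.2⟩),
          ← Submodule.starProjection_eq_self_iff.2 (h.left_mem hk),
          U.inner_starProjection_left_eq_right, (ih' j hj).2, inner_smul_right,
          h.inner_left hk hj]
        simp
    · refine eq_smul_of_forall_inner_le (x := v k) (h.norm_left hk) ?_ ?_ (h.cos_nonneg hk) ?_
      · rw [← real_inner_self_eq_norm_sq, U.inner_starProjection_left_eq_right,
          Submodule.starProjection_eq_self_iff.2 (U.starProjection_apply_mem _)]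
      · rw [U.inner_starProjection_left_eq_right,
          Submodule.starProjection_eq_self_iff.2 (h.left_mem hk), hc, real_inner_comm]
      · intro t ht
        rw [real_inner_comm]
        refine h.le_cos hk (x := (t • U.starProjection (v k), v k)) ⟨
          U.smul_mem _ (U.starProjection_apply_mem _), h.right_mem hk, ht, h.norm_right hk,
          fun j hj => ⟨?_, h.inner_right hk hj⟩⟩
        rw [inner_smul_left, U.inner_starProjection_left_eq_right,
          Submodule.starProjection_eq_self_iff.2 (h.left_mem ⟨hj.1, hj.2.le.trans hk.2⟩),
          ← Submodule.starProjection_eq_self_iff.2 (h.right_mem hk),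
          V.inner_starProjection_left_eq_right, (ih' j hj).1, inner_smul_right,
          h.inner_right hk hj]
        simp

theorem partialRelaxed_apply (hk : k ∈ Set.Icc 1 (finrank ℝ U)) (μ : ℝ) :
    partialRelaxed U V μ (u k) = (1 - μ * Real.sin (θ k) ^ 2) • u k := by
  have h1 : partialRelaxed U V μ (u k) = (1 - μ) • U.starProjection (u k) +
      μ • U.starProjection (V.starProjection (u k)) := rfl
  rw [h1, Submodule.starProjection_eq_self_iff.2 (h.left_mem hk), (h.starProjection_eq hk).1,
    map_smul, (h.starProjection_eq hk).2, smul_smul, smul_smul, ← add_smul, Real.sin_sq]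
  congr 1
  ring

/-- The pair chosen at stage `k` already competes at the less constrained stage `j`. -/
theorem cos_le_cos (hj : j ∈ Set.Icc 1 k) (hk : k ∈ Set.Icc 1 (finrank ℝ U)) :
    Real.cos (θ k) ≤ Real.cos (θ j) := by
  rw [(h k hk).2.2.1]
  obtain ⟨h1, h2, h3, h4, h5⟩ := (h k hk).2.1
  exact h.le_cos ⟨hj.1, hj.2.trans hk.2⟩ (x := (u k, v k))
    ⟨h1, h2, h3, h4, fun i hi => h5 i ⟨hi.1, hi.2.trans_le hj.2⟩⟩

theorem sin_sq_le_sin_sq (hj : j ∈ Set.Icc 1 k) (hk : k ∈ Set.Icc 1 (finrank ℝ U)) :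
    Real.sin (θ j) ^ 2 ≤ Real.sin (θ k) ^ 2 := by
  rw [Real.sin_sq, Real.sin_sq]
  have := h.cos_le_cos hj hk
  have := h.cos_nonneg hk
  gcongr

theorem eq_of_cos_eq_one (hk : k ∈ Set.Icc 1 (finrank ℝ U)) (hc : Real.cos (θ k) = 1) :
    u k = v k :=
  (inner_eq_one_iff_of_norm_eq_one (𝕜 := ℝ) (h.norm_left hk) (h.norm_right hk)).1
    ((h k hk).2.2.1.symm.trans hc)

theorem left_mem_inf_of_cos_eq_one (hk : k ∈ Set.Icc 1 (finrank ℝ U))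
    (hc : Real.cos (θ k) = 1) : u k ∈ U ⊓ V :=
  ⟨h.left_mem hk, h.eq_of_cos_eq_one hk hc ▸ h.right_mem hk⟩

theorem cos_eq_one (hk : 1 ≤ k) (hks : k ≤ finrank ℝ (U ⊓ V : Submodule ℝ _)) :
    Real.cos (θ k) = 1 := by
  induction k using Nat.strong_induction_on with
  | _ k ih =>
    have hsp := Submodule.finrank_mono (inf_le_left : U ⊓ V ≤ U)
    refine le_antisymm (Real.cos_le_one _) ?_
    -- As `k - 1 < s`, some unit vector of `U ∩ V` is orthogonal to the earlier `u j`. By induction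
    -- these equal the `v j`, so `(x, x)` competes.
    obtain ⟨x, hx, hx1, hx2⟩ := exists_unit_orthogonal (U ⊓ V) u (k - 1) (by omega)
    have hk1 : k - 1 + 1 = k := by omega
    rw [hk1] at hx2
    have := h.le_cos ⟨hk, hks.trans hsp⟩ (x := (x, x)) ⟨hx.1, hx.2, hx1, hx1, fun j hj =>
      ⟨hx2 j hj, by
        rw [← h.eq_of_cos_eq_one ⟨hj.1, (hj.2.le.trans hks).trans hsp⟩
          (ih j hj.2 hj.1 (hj.2.le.trans hks))]
        exact hx2 j hj⟩⟩
    simpa [hx1] using this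

theorem orthonormal_left : Orthonormal ℝ (fun i : Fin (finrank ℝ U) => u (i + 1)) := by
  constructor
  · exact fun i => h.norm_left ⟨by omega, by omega⟩
  · intro i j hij
    rcases lt_or_gt_of_ne hij with hlt | hlt
    · rw [real_inner_comm]
      exact h.inner_left ⟨by omega, by omega⟩ ⟨by omega, by simpa using hlt⟩
    · exact h.inner_left ⟨by omega, by omega⟩ ⟨by omega, by simpa using hlt⟩

theorem exists_orthonormalBasis : ∃ b : OrthonormalBasis (Fin (finrank ℝ U)) ℝ U,
    ∀ i, (b i : EuclideanSpace ℝ (Fin n)) = u (i + 1) := by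
  let e : Fin (finrank ℝ U) → U := fun i => ⟨u (i + 1), h.left_mem ⟨by omega, by omega⟩⟩
  have he : Orthonormal ℝ e := by
    have := h.orthonormal_left
    rw [orthonormal_iff_ite] at this ⊢
    exact this
  have hs := he.linearIndependent.span_eq_top_of_card_eq_finrank' (by simp)
  exact ⟨OrthonormalBasis.mk he hs.ge, fun i => by simp [e]⟩

theorem sum_sq_inner {x : EuclideanSpace ℝ (Fin n)} (hx : x ∈ U) :
    ∑ i : Fin (finrank ℝ U), inner ℝ (u (i + 1)) x ^ 2 = ‖x‖ ^ 2 := by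
  obtain ⟨b, hb⟩ := h.exists_orthonormalBasis
  have := b.sum_sq_norm_inner_right ⟨x, hx⟩
  simpa [hb] using this

theorem sum_inner_mul_inner {x y : EuclideanSpace ℝ (Fin n)} (hx : x ∈ U) (hy : y ∈ U) :
    ∑ i : Fin (finrank ℝ U), inner ℝ x (u (i + 1)) * inner ℝ (u (i + 1)) y = inner ℝ x y := by
  obtain ⟨b, hb⟩ := h.exists_orthonormalBasis
  have := b.sum_inner_mul_inner ⟨x, hx⟩ ⟨y, hy⟩
  simpa [hb] using this

/-- Otherwise, by monotonicity, `u 1, …, u k` would be `k > s` independent vectors in `U ∩ V`. -/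
theorem cos_lt_one (hk : finrank ℝ (U ⊓ V : Submodule ℝ _) < k) (hkp : k ≤ finrank ℝ U) :
    Real.cos (θ k) < 1 := by
  refine lt_of_le_of_ne (Real.cos_le_one _) fun hc => ?_
  let e : Fin k → (U ⊓ V : Submodule ℝ _) := fun i => ⟨u (i + 1),
    h.left_mem_inf_of_cos_eq_one ⟨by omega, by omega⟩ (le_antisymm (Real.cos_le_one _)
      (hc ▸ h.cos_le_cos ⟨by omega, by omega⟩ ⟨by omega, hkp⟩))⟩
  have h1 : LinearIndependent ℝ (fun i : Fin k => u (i + 1)) :=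
    h.orthonormal_left.linearIndependent.comp (Fin.castLE hkp) (Fin.castLE_injective hkp)
  have h2 : LinearIndependent ℝ e := LinearIndependent.of_comp (U ⊓ V).subtype h1
  have := h2.fintype_card_le_finrank
  simp only [Fintype.card_fin] at this
  omega

/-- Both projections fix `x`; moving them onto `u_k` gives `⟪u_k, x⟫ = cos² θ_k ⟪u_k, x⟫` with `cos
θ_k < 1`. -/
theorem inner_eq_zero_of_mem_inf (hk : finrank ℝ (U ⊓ V : Submodule ℝ _) < k)
    (hkp : k ≤ finrank ℝ U) {x : EuclideanSpace ℝ (Fin n)} (hx : x ∈ U ⊓ V) :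
    inner ℝ (u k) x = 0 := by
  have hk' : k ∈ Set.Icc 1 (finrank ℝ U) := ⟨by omega, hkp⟩
  have h1 : inner ℝ (u k) x = Real.cos (θ k) * (Real.cos (θ k) * inner ℝ (u k) x) := by
    conv_lhs => rw [← Submodule.starProjection_eq_self_iff.2 hx.2,
      ← V.inner_starProjection_left_eq_right, (h.starProjection_eq hk').1, inner_smul_left,
      ← Submodule.starProjection_eq_self_iff.2 hx.1, ← U.inner_starProjection_left_eq_right,
      (h.starProjection_eq hk').2, inner_smul_left]
    rfl
  have h2 := h.cos_lt_one hk hkp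
  have h3 := h.cos_nonneg hk'
  have h4 : (1 - Real.cos (θ k) ^ 2) * inner ℝ (u k) x = 0 := by linarith
  refine (mul_eq_zero.1 h4).resolve_left ?_
  nlinarith

theorem sin_sq_pos (hk : finrank ℝ (U ⊓ V : Submodule ℝ _) < k) (hkp : k ≤ finrank ℝ U) :
    0 < Real.sin (θ k) ^ 2 := by
  have h2 := h.cos_lt_one hk hkp
  have h3 := h.cos_nonneg (k := k) ⟨by omega, hkp⟩
  rw [Real.sin_sq]
  nlinarith

/-- The pairs competing just after the common directions are exhausted are those
in the definition of the Friedrichs angle. -/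
theorem principalPairs_succ : principalPairs U V u v (finrank ℝ (U ⊓ V : Submodule ℝ _) + 1) =
    {x | x.1 ∈ U ⊓ (U ⊓ V)ᗮ ∧ x.2 ∈ V ⊓ (U ⊓ V)ᗮ ∧ ‖x.1‖ = 1 ∧ ‖x.2‖ = 1} := by
  have hsp := Submodule.finrank_mono (inf_le_left : U ⊓ V ≤ U)
  have hz : ∀ z : EuclideanSpace ℝ (Fin n),
      (∀ j ∈ Set.Ico 1 (finrank ℝ (U ⊓ V : Submodule ℝ _) + 1), inner ℝ z (u j) = 0) ↔
        z ∈ (U ⊓ V)ᗮ := by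
    intro z
    constructor
    · intro hz
      rw [Submodule.mem_orthogonal]
      intro y hy
      -- Expand `⟪y, P_U z⟫` in the basis `u`: for indices up to `s` the factor with `z` vanishes,
      -- beyond `s` the factor with `y` does.
      rw [← Submodule.starProjection_eq_self_iff.2 hy.1, U.inner_starProjection_left_eq_right,
        ← h.sum_inner_mul_inner hy.1 (U.starProjection_apply_mem z)]
      refine Finset.sum_eq_zero fun i _ => ?_
      have hi : ((i : ℕ) + 1) ∈ Set.Icc 1 (finrank ℝ U) := ⟨by omega, by omega⟩
      by_cases his : (i : ℕ) + 1 ≤ finrank ℝ (U ⊓ V : Submodule ℝ _)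
      · rw [← U.inner_starProjection_left_eq_right,
          Submodule.starProjection_eq_self_iff.2 (h.left_mem hi), real_inner_comm z,
          hz _ ⟨by omega, by omega⟩, mul_zero]
      · rw [real_inner_comm, h.inner_eq_zero_of_mem_inf (by omega) hi.2 hy, zero_mul]
    · intro hz j hj
      rw [real_inner_comm]
      exact (Submodule.mem_orthogonal _ _).1 hz _ (h.left_mem_inf_of_cos_eq_one
        ⟨hj.1, by have := hj.2; omega⟩ (h.cos_eq_one hj.1 (by have := hj.2; omega)))
  have huv : ∀ j ∈ Set.Ico 1 (finrank ℝ (U ⊓ V : Submodule ℝ _) + 1), v j = u j := fun j hj =>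
    (h.eq_of_cos_eq_one ⟨hj.1, by have := hj.2; omega⟩
      (h.cos_eq_one hj.1 (by have := hj.2; omega))).symm
  ext x
  simp only [principalPairs, Set.mem_ofPred_eq, Submodule.mem_inf (q := (U ⊓ V)ᗮ), ← hz]
  constructor
  · rintro ⟨h1, h2, h3, h4, h5⟩
    exact ⟨⟨h1, fun j hj => (h5 j hj).1⟩, ⟨h2, fun j hj => huv j hj ▸ (h5 j hj).2⟩, h3, h4⟩
  · rintro ⟨⟨h1, h5⟩, ⟨h2, h6⟩, h3, h4⟩
    exact ⟨h1, h2, h3, h4, fun j hj => ⟨h5 j hj, (huv j hj).symm ▸ h6 j hj⟩⟩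

theorem friedrichsCos_eq (hs : finrank ℝ (U ⊓ V : Submodule ℝ _) < finrank ℝ U) :
    friedrichsCos U V = Real.cos (θ (finrank ℝ (U ⊓ V : Submodule ℝ _) + 1)) := by
  have hg := (h (finrank ℝ (U ⊓ V : Submodule ℝ _) + 1) ⟨by omega, hs⟩).2.2.2
  rw [h.principalPairs_succ] at hg
  rw [← hg.csSup_eq, friedrichsCos]
  congr 1
  ext c
  constructor
  · rintro ⟨x, hx, y, hy, hx1, hy1, rfl⟩
    exact ⟨(x, y), ⟨hx, hy, hx1, hy1⟩, rfl⟩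
  · rintro ⟨x, ⟨hx, hy, hx1, hy1⟩, rfl⟩
    exact ⟨x.1, hx, x.2, hy, hx1, hy1, rfl⟩

end IsPrincipalSystem

end PrincipalVectors

end AltProj

namespace AltProj

/-! ### Powers of the relaxed projection -/

section RelaxedProjections

variable {n : ℕ} {U V : Submodule ℝ (EuclideanSpace ℝ (Fin n))}

theorem starProjection_inf_mul_partialRelaxed (μ : ℝ) :
    (U ⊓ V).starProjection * partialRelaxed U V μ = (U ⊓ V).starProjection := by
  have h1 : (U ⊓ V).starProjection * U.starProjection = (U ⊓ V).starProjection :=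
    Submodule.starProjection_comp_starProjection_of_le inf_le_left
  have h2 : (U ⊓ V).starProjection * V.starProjection = (U ⊓ V).starProjection :=
    Submodule.starProjection_comp_starProjection_of_le inf_le_right
  rw [partialRelaxed, mul_add, mul_smul_comm, mul_smul_comm, ← mul_assoc, h1, h2, ← add_smul]
  simp

theorem partialRelaxed_mul_starProjection_inf (μ : ℝ) :
    partialRelaxed U V μ * (U ⊓ V).starProjection = (U ⊓ V).starProjection := by
  ext1 x
  have hx := (U ⊓ V).starProjection_apply_mem x
  have hU := Submodule.starProjection_eq_self_iff.2 hx.1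
  have hV := Submodule.starProjection_eq_self_iff.2 hx.2
  calc partialRelaxed U V μ ((U ⊓ V).starProjection x)
      = (1 - μ) • U.starProjection ((U ⊓ V).starProjection x) +
        μ • U.starProjection (V.starProjection ((U ⊓ V).starProjection x)) := rfl
    _ = _ := by rw [hV, hU, ← add_smul]; simp

theorem partialRelaxed_apply_mem (μ : ℝ) (x : EuclideanSpace ℝ (Fin n)) :
    partialRelaxed U V μ x ∈ U :=
  U.add_mem (U.smul_mem _ (U.starProjection_apply_mem _))
    (U.smul_mem _ (U.starProjection_apply_mem _))

theorem inner_partialRelaxed_eq (μ : ℝ) {x y : EuclideanSpace ℝ (Fin n)} (hx : x ∈ U)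
    (hy : y ∈ U) : inner ℝ x (partialRelaxed U V μ y) = inner ℝ (partialRelaxed U V μ x) y := by
  have h : ∀ z, partialRelaxed U V μ z = (1 - μ) • U.starProjection z +
    μ • U.starProjection (V.starProjection z) := fun _ => rfl
  rw [h, h, Submodule.starProjection_eq_self_iff.2 hx, Submodule.starProjection_eq_self_iff.2 hy,
    inner_add_right, inner_add_left, inner_smul_right, inner_smul_right, real_inner_smul_left,
    real_inner_smul_left, ← U.inner_starProjection_left_eq_right,
    Submodule.starProjection_eq_self_iff.2 hx, U.inner_starProjection_left_eq_right,
    Submodule.starProjection_eq_self_iff.2 hy, V.inner_starProjection_left_eq_right]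

/-- `P_{U∩V}` is idempotent and is absorbed by `S_μ` on both sides, so the cross terms vanish. The
exponent 0 is excluded, since there the right side would be `1 + P_{U∩V}`. -/
theorem partialRelaxed_pow_succ (μ : ℝ) (k : ℕ) : partialRelaxed U V μ ^ (k + 1) =
    (partialRelaxed U V μ - (U ⊓ V).starProjection) ^ (k + 1) + (U ⊓ V).starProjection := by
  have hPP : (U ⊓ V).starProjection * (U ⊓ V).starProjection = (U ⊓ V).starProjection :=
    Submodule.starProjection_comp_starProjection_of_le le_rfl
  set S := partialRelaxed U V μ with hS
  set P := (U ⊓ V).starProjection with hP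
  have h1 : (S - P) * P = 0 := by
    rw [sub_mul, hPP, partialRelaxed_mul_starProjection_inf, sub_self]
  have h2 : P * (S - P) = 0 := by
    rw [mul_sub, hPP, starProjection_inf_mul_partialRelaxed, sub_self]
  induction k with
  | zero => simp
  | succ k ih =>
    calc S ^ (k + 1 + 1) = ((S - P) ^ (k + 1) + P) * ((S - P) + P) := by
          rw [pow_succ, ih, sub_add_cancel]
      _ = (S - P) ^ (k + 1) * (S - P) + (S - P) ^ k * ((S - P) * P) + P * (S - P) + P * P := by
          rw [add_mul, mul_add, mul_add, ← mul_assoc, ← pow_succ, ← pow_succ,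
            add_assoc _ (P * _)]
      _ = _ := by rw [h1, h2, hPP, mul_zero, add_zero, add_zero, ← pow_succ]

theorem convergesTo_starProjection (W : Submodule ℝ (EuclideanSpace ℝ (Fin n))) :
    ConvergesTo W.starProjection W.starProjection := by
  have hW : W.starProjection * W.starProjection = W.starProjection :=
    Submodule.starProjection_comp_starProjection_of_le le_rfl
  refine tendsto_const_nhds.congr' ((eventually_ge_atTop 1).mono fun k hk => ?_)
  simp only [IsIdempotentElem.pow_eq hW (by omega : k ≠ 0), sub_self, norm_zero]

theorem convergesTo_partialRelaxed_of_le (hUV : U ≤ V) (μ : ℝ) :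
    ConvergesTo (partialRelaxed U V μ) (U ⊓ V).starProjection := by
  have h1 : U.starProjection * V.starProjection = U.starProjection :=
    Submodule.starProjection_comp_starProjection_of_le hUV
  have h2 : partialRelaxed U V μ = (U ⊓ V).starProjection := by
    have h3 : U ⊓ V = U := inf_eq_left.2 hUV
    rw [partialRelaxed, h1, ← add_smul]
    simp [h3]
  rw [h2]
  exact convergesTo_starProjection _

/-- The limit is `P_U`, not `P_{U∩V}` unless `U ≤ V`; hence `μ = 0` is kept apart from the rate
statements. -/
theorem convergent_partialRelaxed_zero : Convergent (partialRelaxed U V 0) :=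
  ⟨U.starProjection, by simpa [partialRelaxed] using convergesTo_starProjection U⟩

namespace IsPrincipalSystem

variable {θ : ℕ → ℝ} {u v : ℕ → EuclideanSpace ℝ (Fin n)} (h : IsPrincipalSystem U V θ u v)
include h

theorem norm_partialRelaxed_sub_apply_le {μ ρ : ℝ} (hρ0 : 0 ≤ ρ)
    (hρ : ∀ k, finrank ℝ (U ⊓ V : Submodule ℝ _) < k → k ≤ finrank ℝ U →
      |1 - μ * Real.sin (θ k) ^ 2| ≤ ρ) {x : EuclideanSpace ℝ (Fin n)} (hx : x ∈ U) :
    ‖(partialRelaxed U V μ - (U ⊓ V).starProjection) x‖ ≤ ρ * ‖x‖ := by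
  have hD : (partialRelaxed U V μ - (U ⊓ V).starProjection) x ∈ U :=
    U.sub_mem (partialRelaxed_apply_mem μ x) ((U ⊓ V).starProjection_apply_mem x).1
  refine le_of_sq_le_sq ?_ (by positivity)
  -- Compare coefficients in the basis `u`: each is multiplied by 0 up to index `s`, and by `1 - μ
  -- sin² θ_k` beyond it.
  rw [mul_pow, ← h.sum_sq_inner hx, ← h.sum_sq_inner hD, Finset.mul_sum]
  refine Finset.sum_le_sum fun i _ => ?_
  have hi : ((i : ℕ) + 1) ∈ Set.Icc 1 (finrank ℝ U) := ⟨by omega, by omega⟩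
  rw [sub_apply, inner_sub_right, inner_partialRelaxed_eq μ (h.left_mem hi) hx,
    h.partialRelaxed_apply hi, inner_smul_left, ← (U ⊓ V).inner_starProjection_left_eq_right]
  by_cases his : (i : ℕ) + 1 ≤ finrank ℝ (U ⊓ V : Submodule ℝ _)
  · have hc := h.cos_eq_one hi.1 his
    rw [Submodule.starProjection_eq_self_iff.2 (h.left_mem_inf_of_cos_eq_one hi hc),
      Real.sin_sq, hc]
    simp only [one_pow, sub_self, mul_zero, sub_zero, map_one, one_mul, ne_eq, OfNat.ofNat_ne_zero,
      not_false_eq_true, zero_pow]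
    positivity
  · have hz : (U ⊓ V).starProjection (u (i + 1)) = 0 := by
      rw [Submodule.starProjection_apply_eq_zero_iff, Submodule.mem_orthogonal]
      intro y hy
      rw [real_inner_comm]
      exact h.inner_eq_zero_of_mem_inf (by omega) hi.2 hy
    rw [hz, inner_zero_left, sub_zero, mul_pow]
    exact mul_le_mul_of_nonneg_right (sq_le_sq.2 ((hρ _ (by omega) hi.2).trans (le_abs_self ρ)))
      (sq_nonneg _)

theorem isConvergenceRate {μ ρ : ℝ} (hρ0 : 0 ≤ ρ) (hρ1 : ρ < 1)
    (hρ : ∀ k, finrank ℝ (U ⊓ V : Submodule ℝ _) < k → k ≤ finrank ℝ U →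
      |1 - μ * Real.sin (θ k) ^ 2| ≤ ρ) :
    IsConvergenceRate (partialRelaxed U V μ) (U ⊓ V).starProjection ρ := by
  set D := partialRelaxed U V μ - (U ⊓ V).starProjection with hD
  -- The contraction by `ρ` holds only on `U`: the first application of `D` costs `‖D‖` and lands in
  -- `U`, each later one gains `ρ`.
  have hpow : ∀ (k : ℕ) (x : EuclideanSpace ℝ (Fin n)),
      (D ^ (k + 1)) x ∈ U ∧ ‖(D ^ (k + 1)) x‖ ≤ ‖D‖ * ρ ^ k * ‖x‖ := by
    intro k x
    induction k with
    | zero =>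
      rw [zero_add, pow_one, pow_zero, mul_one]
      exact ⟨U.sub_mem (partialRelaxed_apply_mem μ x) ((U ⊓ V).starProjection_apply_mem x).1,
        D.le_opNorm x⟩
    | succ k ih =>
      rw [pow_succ', mul_apply_eq_comp]
      refine ⟨U.sub_mem (partialRelaxed_apply_mem μ _) ((U ⊓ V).starProjection_apply_mem _).1,
        (h.norm_partialRelaxed_sub_apply_le hρ0 hρ ih.1).trans ?_⟩
      calc ρ * ‖(D ^ (k + 1)) x‖ ≤ ρ * (‖D‖ * ρ ^ k * ‖x‖) := by gcongr; exact ih.2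
        _ = _ := by ring
  -- Dividing by `ρ` absorbs the lost first factor; adding 1 keeps the constant positive. With `N =
  -- 1` the shifted exponent is nonzero, which settles `ρ = 0`.
  refine ⟨⟨hρ0, hρ1⟩, ‖D‖ / ρ + 1, by positivity, 1, one_pos, fun k hk => ?_⟩
  obtain ⟨k, rfl⟩ := Nat.exists_eq_add_of_le' hk.le
  rw [partialRelaxed_pow_succ, add_sub_cancel_right]
  refine (ContinuousLinearMap.opNorm_le_bound _ (by positivity) fun x => (hpow k x).2).trans ?_
  rcases eq_or_ne ρ 0 with rfl | h0
  · rw [zero_pow (by omega : k ≠ 0)]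
    simp
  · calc ‖D‖ * ρ ^ k = ‖D‖ / ρ * ρ ^ (k + 1) := by rw [pow_succ']; field_simp
      _ ≤ _ := by
        gcongr
        linarith

theorem mem_complexSpectrum {k : ℕ} (hk : k ∈ Set.Icc 1 (finrank ℝ U)) (μ : ℝ) :
    ((1 - μ * Real.sin (θ k) ^ 2 : ℝ) : ℂ) ∈ complexSpectrum (partialRelaxed U V μ) :=
  ofReal_mem_complexSpectrum (norm_ne_zero_iff.1 (by rw [h.norm_left hk]; exact one_ne_zero))
    (h.partialRelaxed_apply hk μ)

theorem ofReal_ne_one {k : ℕ} (hk : finrank ℝ (U ⊓ V : Submodule ℝ _) < k)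
    (hkp : k ≤ finrank ℝ U) {μ : ℝ} (hμ : μ ≠ 0) :
    ((1 - μ * Real.sin (θ k) ^ 2 : ℝ) : ℂ) ≠ 1 := by
  have h1 := mul_ne_zero hμ (h.sin_sq_pos hk hkp).ne'
  norm_cast
  intro h2
  exact h1 (by linarith)

theorem abs_le_of_isConvergenceRate {k : ℕ} (hk : finrank ℝ (U ⊓ V : Submodule ℝ _) < k)
    (hkp : k ≤ finrank ℝ U) {μ r : ℝ} (hμ : μ ≠ 0)
    {L : EuclideanSpace ℝ (Fin n) →L[ℝ] EuclideanSpace ℝ (Fin n)}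
    (hr : IsConvergenceRate (partialRelaxed U V μ) L r) :
    |1 - μ * Real.sin (θ k) ^ 2| ≤ r := by
  have := hr.norm_le (h.mem_complexSpectrum ⟨by omega, hkp⟩ μ) (h.ofReal_ne_one hk hkp hμ)
  rwa [Complex.norm_real, Real.norm_eq_abs] at this

/-- When the extreme eigenvalue of `S_μ` in absolute value is the one at index `k`, its absolute
value is the optimal rate of `S_μ`. -/
theorem isOptimalRate {k : ℕ} (hk : finrank ℝ (U ⊓ V : Submodule ℝ _) < k)
    (hkp : k ≤ finrank ℝ U) {μ ρ : ℝ} (hμ : μ ≠ 0) (hρ1 : ρ < 1)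
    (hρk : |1 - μ * Real.sin (θ k) ^ 2| = ρ)
    (hρ : ∀ k, finrank ℝ (U ⊓ V : Submodule ℝ _) < k → k ≤ finrank ℝ U →
      |1 - μ * Real.sin (θ k) ^ 2| ≤ ρ) :
    ConvergesTo (partialRelaxed U V μ) (U ⊓ V).starProjection ∧
      IsOptimalRate (partialRelaxed U V μ) (U ⊓ V).starProjection
        (subdominantModulus (partialRelaxed U V μ)) ∧
      subdominantModulus (partialRelaxed U V μ) = ρ := by
  have hrate := h.isConvergenceRate (hρk ▸ abs_nonneg _) hρ1 hρ
  obtain ⟨h1, h2⟩ := hrate.isOptimalRate_of_mem (h.mem_complexSpectrum ⟨by omega, hkp⟩ μ)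
    (h.ofReal_ne_one hk hkp hμ) (by rw [Complex.norm_real, Real.norm_eq_abs, hρk])
  exact ⟨hrate.convergesTo, h2.symm ▸ h1, h2⟩

end IsPrincipalSystem

end RelaxedProjections

end AltProj

/-! ### Optimising over `μ` -/

theorem theorem3p7 (n p q s : ℕ) (U V : Submodule ℝ (EuclideanSpace ℝ (Fin n)))
    (hp : p = Module.finrank ℝ U) (hq : q = Module.finrank ℝ V)
    (hs : s = Module.finrank ℝ (U ⊓ V : Submodule ℝ (EuclideanSpace ℝ (Fin n))))
    (hp1 : 1 ≤ p) (hpq : p ≤ q) (hqn : q < n)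
    (θ : ℕ → ℝ) (hθ : AltProj.IsPrincipalAngles U V θ) :
    -- the degenerate case
    (U ≤ V → ∀ μ : ℝ,
      AltProj.ConvergesTo (AltProj.partialRelaxed U V μ) (U ⊓ V).starProjection) ∧
    -- the main case, in which `s + 1 ≤ p`
    (¬ U ≤ V →
      (∀ μ : ℝ, AltProj.Convergent (AltProj.partialRelaxed U V μ) ↔
        μ ∈ Set.Ico 0 (2 / Real.sin (θ p) ^ 2)) ∧
      (∀ μ ∈ Set.Ioc 0 (2 / (Real.sin (θ (s + 1)) ^ 2 + Real.sin (θ p) ^ 2)),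
        AltProj.ConvergesTo (AltProj.partialRelaxed U V μ) (U ⊓ V).starProjection ∧
        AltProj.IsOptimalRate (AltProj.partialRelaxed U V μ) (U ⊓ V).starProjection
          (AltProj.subdominantModulus (AltProj.partialRelaxed U V μ)) ∧
        AltProj.subdominantModulus (AltProj.partialRelaxed U V μ) =
          1 - μ * Real.sin (θ (s + 1)) ^ 2) ∧
      (∀ μ ∈ Set.Ioo (2 / (Real.sin (θ (s + 1)) ^ 2 + Real.sin (θ p) ^ 2))
          (2 / Real.sin (θ p) ^ 2),
        AltProj.ConvergesTo (AltProj.partialRelaxed U V μ) (U ⊓ V).starProjection ∧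
        AltProj.IsOptimalRate (AltProj.partialRelaxed U V μ) (U ⊓ V).starProjection
          (AltProj.subdominantModulus (AltProj.partialRelaxed U V μ)) ∧
        AltProj.subdominantModulus (AltProj.partialRelaxed U V μ) =
          μ * Real.sin (θ p) ^ 2 - 1) ∧
      Real.cos (θ (s + 1)) ^ 2 = AltProj.friedrichsCos U V ^ 2 ∧
      (∀ μ : ℝ, μ ≠ 0 →
        ((AltProj.ConvergesTo (AltProj.partialRelaxed U V μ) (U ⊓ V).starProjection ∧
          ∃ r : ℝ,
            AltProj.IsOptimalRate (AltProj.partialRelaxed U V μ) (U ⊓ V).starProjection r ∧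
            r < Real.cos (θ (s + 1)) ^ 2) ↔
          μ ∈ Set.Ioo 1 ((2 - Real.sin (θ (s + 1)) ^ 2) / Real.sin (θ p) ^ 2))) ∧
      AltProj.IsOptimalRate
        (AltProj.partialRelaxed U V (2 / (Real.sin (θ (s + 1)) ^ 2 + Real.sin (θ p) ^ 2)))
        (U ⊓ V).starProjection
        ((Real.sin (θ p) ^ 2 - Real.sin (θ (s + 1)) ^ 2) /
          (Real.sin (θ (s + 1)) ^ 2 + Real.sin (θ p) ^ 2)) ∧
      (∀ μ : ℝ, μ ≠ 0 →
        ∀ (L : EuclideanSpace ℝ (Fin n) →L[ℝ] EuclideanSpace ℝ (Fin n)) (r : ℝ),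
          AltProj.IsConvergenceRate (AltProj.partialRelaxed U V μ) L r →
          (Real.sin (θ p) ^ 2 - Real.sin (θ (s + 1)) ^ 2) /
            (Real.sin (θ (s + 1)) ^ 2 + Real.sin (θ p) ^ 2) ≤ r)) := by
  obtain ⟨u, v, h⟩ := hθ
  replace h : AltProj.IsPrincipalSystem U V θ u v := h
  subst hp hq hs
  refine ⟨fun hUV μ => AltProj.convergesTo_partialRelaxed_of_le hUV μ, fun hUV => ?_⟩
  set p := finrank ℝ U with hp
  set s := finrank ℝ (U ⊓ V : Submodule ℝ (EuclideanSpace ℝ (Fin n))) with hs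
  have hsp : s < p := Submodule.finrank_lt_finrank_of_lt
    (lt_of_le_of_ne inf_le_left fun he => hUV (inf_eq_left.1 he))
  have ha := h.sin_sq_pos (k := s + 1) (by omega) hsp
  have hab := h.sin_sq_le_sin_sq (j := s + 1) (k := p) ⟨by omega, hsp⟩ ⟨hp1, le_rfl⟩
  have hk : ∀ k, s < k → k ≤ p → Real.sin (θ (s + 1)) ^ 2 ≤ Real.sin (θ k) ^ 2 ∧
      Real.sin (θ k) ^ 2 ≤ Real.sin (θ p) ^ 2 := fun k hsk hkp =>
    ⟨h.sin_sq_le_sin_sq ⟨by omega, hsk⟩ ⟨by omega, hkp⟩,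
      h.sin_sq_le_sin_sq ⟨by omega, hkp⟩ ⟨hp1, le_rfl⟩⟩
  have hspec := h.mem_complexSpectrum (k := p) ⟨hp1, le_rfl⟩
  have hne := fun μ (hμ : μ ≠ 0) => h.ofReal_ne_one hsp le_rfl hμ
  have hra := fun μ r (hμ : μ ≠ 0) L => h.abs_le_of_isConvergenceRate (k := s + 1) (by omega) hsp
    (μ := μ) (r := r) hμ (L := L)
  have hrb := fun μ r (hμ : μ ≠ 0) L => h.abs_le_of_isConvergenceRate hsp le_rfl
    (μ := μ) (r := r) hμ (L := L)
  have hoa := fun μ ρ => h.isOptimalRate (k := s + 1) (μ := μ) (ρ := ρ) (by omega) hsp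
  have hob := fun μ ρ => h.isOptimalRate (μ := μ) (ρ := ρ) hsp le_rfl
  have hb1 := Real.sin_sq_le_one (θ p)
  have hcos : Real.cos (θ (s + 1)) ^ 2 = 1 - Real.sin (θ (s + 1)) ^ 2 := Real.cos_sq' _
  have hF : Real.cos (θ (s + 1)) ^ 2 = AltProj.friedrichsCos U V ^ 2 := by
    rw [h.friedrichsCos_eq hsp]
  set a := Real.sin (θ (s + 1)) ^ 2
  set b := Real.sin (θ p) ^ 2
  have hb : 0 < b := ha.trans_le hab
  -- `μ (a + b) ≤ 2` says `μ b - 1 ≤ 1 - μ a`, so the endpoint `a` dominates; in `hlarge` the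
  -- inequality is reversed and `b` dominates.
  have hsmall : ∀ μ ∈ Set.Ioc 0 (2 / (a + b)),
      AltProj.ConvergesTo (AltProj.partialRelaxed U V μ) (U ⊓ V).starProjection ∧
        AltProj.IsOptimalRate (AltProj.partialRelaxed U V μ) (U ⊓ V).starProjection
          (AltProj.subdominantModulus (AltProj.partialRelaxed U V μ)) ∧
        AltProj.subdominantModulus (AltProj.partialRelaxed U V μ) = 1 - μ * a := by
    rintro μ ⟨h0, h1⟩
    rw [le_div_iff₀ (by positivity)] at h1
    have h2 : 0 < μ * a := mul_pos h0 ha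
    have h3 : μ * a ≤ μ * b := mul_le_mul_of_nonneg_left hab h0.le
    refine hoa μ _ h0.ne' (by linarith) (abs_of_nonneg (by linarith)) fun k hsk hkp => ?_
    have h4 := mul_le_mul_of_nonneg_left (hk k hsk hkp).1 h0.le
    have h5 := mul_le_mul_of_nonneg_left (hk k hsk hkp).2 h0.le
    rw [abs_le]
    constructor <;> linarith
  have hlarge : ∀ μ ∈ Set.Ioo (2 / (a + b)) (2 / b),
      AltProj.ConvergesTo (AltProj.partialRelaxed U V μ) (U ⊓ V).starProjection ∧
        AltProj.IsOptimalRate (AltProj.partialRelaxed U V μ) (U ⊓ V).starProjection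
          (AltProj.subdominantModulus (AltProj.partialRelaxed U V μ)) ∧
        AltProj.subdominantModulus (AltProj.partialRelaxed U V μ) = μ * b - 1 := by
    rintro μ ⟨h1, h2⟩
    have h0 : 0 < μ := lt_trans (by positivity) h1
    rw [div_lt_iff₀ (by positivity)] at h1
    rw [lt_div_iff₀ hb] at h2
    have h3 : μ * a ≤ μ * b := mul_le_mul_of_nonneg_left hab h0.le
    refine hob μ _ h0.ne' (by linarith) (by rw [abs_sub_comm]; exact abs_of_nonneg (by linarith))
      fun k hsk hkp => ?_
    have h4 := mul_le_mul_of_nonneg_left (hk k hsk hkp).1 h0.le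
    have h5 := mul_le_mul_of_nonneg_left (hk k hsk hkp).2 h0.le
    rw [abs_le]
    constructor <;> linarith
  have hconv : ∀ μ : ℝ, AltProj.Convergent (AltProj.partialRelaxed U V μ) ↔
      μ ∈ Set.Ico 0 (2 / b) := by
    intro μ
    constructor
    · intro hc
      rcases eq_or_ne μ 0 with rfl | h0
      · exact ⟨le_rfl, by positivity⟩
      · have h1 := (hc.eq_one_or_norm_lt_one (hspec μ)).resolve_left (hne μ h0)
        rw [Complex.norm_real, Real.norm_eq_abs, abs_lt] at h1
        exact ⟨(pos_of_mul_pos_left (by linarith : 0 < μ * b) hb.le).le,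
          (lt_div_iff₀ hb).2 (by linarith)⟩
    · rintro ⟨h0, h1⟩
      rcases h0.eq_or_lt with rfl | h0
      · exact AltProj.convergent_partialRelaxed_zero
      · rcases le_or_gt μ (2 / (a + b)) with h2 | h2
        · exact ⟨_, (hsmall μ ⟨h0, h2⟩).1⟩
        · exact ⟨_, (hlarge μ ⟨h2, h1⟩).1⟩
  refine ⟨hconv, hsmall, hlarge, hF, ?_, ?_, ?_⟩
  · intro μ h0
    rw [hcos, Set.mem_Ioo, lt_div_iff₀ hb]
    constructor
    · rintro ⟨hc, r, hr, hlt⟩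
      -- `1 - μ a ≤ r < 1 - a` forces `1 < μ`, and `μ b - 1 ≤ r < 1 - a` forces `μ b < 2 - a`.
      have h1 := (abs_le.1 (hra μ r h0 _ hr.1)).2
      have h2 := (abs_le.1 (hrb μ r h0 _ hr.1)).1
      exact ⟨lt_of_mul_lt_mul_right (by linarith : 1 * a < μ * a) ha.le, by linarith⟩
    · rintro ⟨h1, h2⟩
      have hμ : 0 < μ := one_pos.trans h1
      rcases le_or_gt μ (2 / (a + b)) with h3 | h3
      · obtain ⟨g1, g2, g3⟩ := hsmall μ ⟨hμ, h3⟩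
        refine ⟨g1, _, g2, ?_⟩
        rw [g3]
        nlinarith
      · obtain ⟨g1, g2, g3⟩ := hlarge μ ⟨h3, (lt_div_iff₀ hb).2 (by linarith)⟩
        refine ⟨g1, _, g2, ?_⟩
        rw [g3]
        linarith
  · obtain ⟨-, g2, g3⟩ := hsmall (2 / (a + b)) ⟨by positivity, le_rfl⟩
    rw [g3] at g2
    convert g2 using 1
    field_simp
    ring
  · intro μ h0 L r hr
    have h1 := (abs_le.1 (hra μ r h0 L hr)).2
    have h2 := (abs_le.1 (hrb μ r h0 L hr)).1
    rw [div_le_iff₀ (by positivity)]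
    -- Weighting `1 - μ a ≤ r` by `b` and `μ b - 1 ≤ r` by `a` cancels `μ`: `b - a ≤ r (a + b)`.
    nlinarith
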